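/- Let $\Bbbk$ be a field and let $\mathcal{A}$ be a $\Bbbk$-linear length abelian category (an abelian category in which every object has finite length). Let $\Theta=(\Theta(1),\dots,\Theta(t))$ be a mixed standardizable set in $\mathcal{A}$, that is: each $\Theta(i)$ is a brick ($\operatorname{End}_{\mathcal{A}}(\Theta(i))$ is a division ring) or a stone (indecomposable with $\operatorname{Ext}^1_{\mathcal{A}}(\Theta(i),\Theta(i))=0$), and $\operatorname{Hom}_{\mathcal{A}}(\Theta(i),\Theta(j))=0=\operatorname{Ext}^1_{\mathcal{A}}(\Theta(i),\Theta(j))$ for all $i>j$. Identify $\Theta$ with $\bigoplus_i\Theta(i)$, let $\mathsf{add}\,\Theta$ be the full subcategory of direct summands of finite direct sums of copies of $\Theta$, and let $\mathcal{F}(\Theta)=\bigcup_{l>0}\mathsf{add}\,\Theta*\cdots*\mathsf{add}\,\Theta$ ($l$ factors), where $\mathcal{X}*\mathcal{Y}$ consists of the objects $Z$ admitting a short exact sequence $0\to X\to Z\to Y\to 0$ with $X\in\mathcal{X}$, $Y\in\mathcal{Y}$. Assume that $\operatorname{Ext}^1_{\mathcal{A}}(M,N)$ is finite dimensional over $\Bbbk$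 for all $M,N\in\mathsf{add}\,\Theta$. For an object $N$ put $D_N=\operatorname{End}_{\mathcal{A}}(N)^{\mathrm{op}}$ if $N$ is a brick and $D_N=\Bbbk$ otherwise. A universal extension of $M$ by $N$ is a short exact sequence $0\to N^{\oplus d}\to E\to M\to 0$ such that the components in $\operatorname{Ext}^1_{\mathcal{A}}(M,N)$ of its class in $\operatorname{Ext}^1_{\mathcal{A}}(M,N^{\oplus d})$ form a basis of the right $D_N$-module $\operatorname{Ext}^1_{\mathcal{A}}(M,N)$ (so $E\to M$ is an isomorphism if $d=0$). The category $\mathcal{A}$ admits a finite sequence of universal extensions by $\Theta$ if for every $i$ and every $M\in\mathcal{A}$ the space $\operatorname{Ext}^1_{\mathcal{A}}(M,\Theta(i))$ is finite dimensional over $D_{\Theta(i)}$ and, in the sequence $\cdots\to P_2\xrightarrow{a_2}P_1\xrightarrow{a_1}P_0=M$ in which each $a_s$ is the epimorphism of a universal extension of $P_{s-1}$ by $\Theta(i)$, some $a_s$ ($s\ge 1$) is an isomorphism. Finite sequences of universal coextensions are defined dually, by short exact sequences $0\to M\to E\to N^{\oplus d}\to 0$. (1) If $\mathcal{A}$ admits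 a finite sequence of universal extensions by $\Theta$, then $\mathcal{F}(\Theta)$ is covariantly finite in $\mathcal{A}$: every $M\in\mathcal{A}$ has a morphism $M\to X$ with $X\in\mathcal{F}(\Theta)$ through which every morphism from $M$ to an object of $\mathcal{F}(\Theta)$ factors. (2) If in addition $\mathcal{A}$ admits a finite sequence of universal coextensions by $\Theta$, then $\mathcal{F}(\Theta)$ is functorially finite in $\mathcal{A}$, i.e. covariantly finite and (dually) contravariantly finite. -/

import Mathlib

open CategoryTheory CategoryTheory.Limits CategoryTheory.Abelian

attribute [local instance] CategoryTheory.Abelian.hasFiniteBiproducts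

universe w v u t

noncomputable section

namespace MixedStd

variable {A : Type u} [Category.{v} A] [Abelian A]

/-- A length abelian category: every object has finite length, i.e. is both noetherian and
artinian. -/
def IsLengthCategory (A : Type u) [Category.{v} A] : Prop :=
  ∀ X : A, IsNoetherianObject X ∧ IsArtinianObject X

/-- `X` is a direct summand of a finite direct sum of copies of `M`. -/
def add (M : A) : ObjectProperty A :=
  fun X => ∃ (n : ℕ) (Y : A), Nonempty ((X ⊞ Y) ≅ ⨁ fun _ : Fin n => M)

/-- `P ∗ Q`: the objects `Z` that admit a short exact sequence `0 ⟶ X ⟶ Z ⟶ Y ⟶ 0` with `X` in `P`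
and `Y` in `Q`. -/
def star (P Q : ObjectProperty A) : ObjectProperty A :=
  fun Z => ∃ (X Y : A) (f : X ⟶ Z) (g : Z ⟶ Y) (h : f ≫ g = 0),
    (ShortComplex.mk f g h).ShortExact ∧ P X ∧ Q Y

/-- `starPow P l = P ∗ ⋯ ∗ P` with `l + 1` factors (the operation `∗` is associative). -/
def starPow (P : ObjectProperty A) : ℕ → ObjectProperty A
  | 0 => P
  | l + 1 => star (starPow P l) P

/-- `ℱ(M)`, the union over `l > 0` of `add M ∗ ⋯ ∗ add M` (`l` factors). -/
def filt (M : A) : ObjectProperty A :=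
  fun X => ∃ l : ℕ, starPow (add M) l X

/-- `f : M ⟶ X` is a left `P`-approximation of `M`. -/
def IsLeftApproximation (P : ObjectProperty A) {M X : A} (f : M ⟶ X) : Prop :=
  P X ∧ ∀ (Y : A), P Y → ∀ g : M ⟶ Y, ∃ h : X ⟶ Y, f ≫ h = g

/-- `f : X ⟶ M` is a right `P`-approximation of `M`. -/
def IsRightApproximation (P : ObjectProperty A) {M X : A} (f : X ⟶ M) : Prop :=
  P X ∧ ∀ (Y : A), P Y → ∀ g : Y ⟶ M, ∃ h : Y ⟶ X, h ≫ f = g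

/-- Every object has a left `P`-approximation. -/
def CovariantlyFinite (P : ObjectProperty A) : Prop :=
  ∀ M : A, ∃ (X : A) (f : M ⟶ X), IsLeftApproximation P f

/-- Every object has a right `P`-approximation. -/
def ContravariantlyFinite (P : ObjectProperty A) : Prop :=
  ∀ M : A, ∃ (X : A) (f : X ⟶ M), IsRightApproximation P f

def FunctoriallyFinite (P : ObjectProperty A) : Prop :=
  CovariantlyFinite P ∧ ContravariantlyFinite P

/-- `N` is a brick: its endomorphism ring is a division ring. -/
def IsBrick (N : A) : Prop :=
  Nontrivial (End N) ∧ ∀ f : End N, f ≠ 0 → IsUnit f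

section Ext

variable [HasExt.{w} A]

/-- `N` is a stone: it is indecomposable and `Ext¹(N, N) = 0`. -/
def IsStone (N : A) : Prop :=
  Indecomposable N ∧ ∀ e : Ext.{w} N N 1, e = 0

/-- A mixed standardizable set `(Θ(1), …, Θ(t))` in an abelian category. (For an abelian category
the negative first extension bifunctor is zero, so it imposes no condition.) -/
structure IsMixedStandardizable {n : ℕ} (Θ : Fin n → A) : Prop where
  brick_or_stone : ∀ i, IsBrick (Θ i) ∨ IsStone.{w} (Θ i)
  hom_eq_zero : ∀ i j, j < i → ∀ f : Θ i ⟶ Θ j, f = 0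
  ext_eq_zero : ∀ i j, j < i → ∀ e : Ext.{w} (Θ i) (Θ j) 1, e = 0

/-- `P` is `Ext`-finite over the field `k`: `Ext¹(M, N)` is finite dimensional for `M`, `N` in
`P`. -/
def ExtFinite (k : Type t) [Field k] [Linear k A] (P : ObjectProperty A) : Prop :=
  ∀ M N : A, P M → P N → Module.Finite k (Ext.{w} M N 1)

/-- `Ext¹(M, N)` as a left `End N`-module, that is, a right `(End N)ᵐᵒᵖ`-module, by postcomposition.
(In `End N` the product `φ * ψ` is the composition `φ ∘ ψ`.) -/
instance extEndModule (M N : A) : Module (End N) (Ext.{w} M N 1) where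
  smul φ e := e.comp (Ext.mk₀ φ) (add_zero 1)
  one_smul e := Ext.comp_mk₀_id e
  mul_smul φ ψ e := by
    change e.comp (Ext.mk₀ (ψ ≫ φ)) (add_zero 1) =
      (e.comp (Ext.mk₀ ψ) (add_zero 1)).comp (Ext.mk₀ φ) (add_zero 1)
    rw [← Ext.mk₀_comp_mk₀]
    exact (Ext.comp_assoc_of_third_deg_zero _ _ _ _).symm
  smul_zero φ := Ext.zero_comp _ _ (Ext.mk₀ φ) 1 (add_zero 1)
  smul_add φ e e' := Ext.add_comp _ _ _ _
  add_smul φ ψ e := by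
    change e.comp (Ext.mk₀ (φ + ψ)) (add_zero 1) =
      e.comp (Ext.mk₀ φ) (add_zero 1) + e.comp (Ext.mk₀ ψ) (add_zero 1)
    rw [Ext.mk₀_add, Ext.comp_add]
  zero_smul e := by
    change e.comp (Ext.mk₀ (0 : N ⟶ N)) (add_zero 1) = 0
    rw [Ext.mk₀_zero, Ext.comp_zero]

/-- `Ext¹(N, M)` as a right `End N`-module, by precomposition. -/
instance extEndOpModule (N M : A) : Module (End N)ᵐᵒᵖ (Ext.{w} N M 1) where
  smul φ e := (Ext.mk₀ φ.unop).comp e (zero_add 1)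
  one_smul e := Ext.mk₀_id_comp e
  mul_smul φ ψ e := by
    change (Ext.mk₀ (φ.unop ≫ ψ.unop)).comp e (zero_add 1) =
      (Ext.mk₀ φ.unop).comp ((Ext.mk₀ ψ.unop).comp e (zero_add 1)) (zero_add 1)
    rw [← Ext.mk₀_comp_mk₀]
    exact Ext.comp_assoc _ _ _ (zero_add 0) (zero_add 1) (by lia)
  smul_zero φ := Ext.comp_zero (Ext.mk₀ φ.unop) M 1 1 (zero_add 1)
  smul_add φ e e' := Ext.comp_add _ _ _ _
  add_smul φ ψ e := by
    change (Ext.mk₀ (φ.unop + ψ.unop)).comp e (zero_add 1) =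
      (Ext.mk₀ φ.unop).comp e (zero_add 1) + (Ext.mk₀ ψ.unop).comp e (zero_add 1)
    rw [Ext.mk₀_add, Ext.add_comp]
  zero_smul e := by
    change (Ext.mk₀ (0 : N ⟶ N)).comp e (zero_add 1) = 0
    rw [Ext.mk₀_zero, Ext.zero_comp]

/-- `0 ⟶ N^d ⟶ E ⟶ M ⟶ 0` is a `D`-universal extension of `M` by `N`: the sequence is exact and
the components in `Ext¹(M, N)` of its class in `Ext¹(M, N^d)` form a `D`-basis of `Ext¹(M, N)`.
(Equivalently it is the pullback along the diagonal `M ⟶ M^d` of the direct sum of the extensions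
given by a basis. In particular `d = dim_D Ext¹(M, N)`, and `E ⟶ M` is an isomorphism when
`d = 0`.) -/
def IsUniversalExtensionOver (D : Type*) [Ring D] {M N E : A} [Module D (Ext.{w} M N 1)] {d : ℕ}
    (f : (⨁ fun _ : Fin d => N) ⟶ E) (g : E ⟶ M) : Prop :=
  ∃ (h : f ≫ g = 0) (hS : (ShortComplex.mk f g h).ShortExact)
    (b : Module.Basis (Fin d) D (Ext.{w} M N 1)),
    ∀ i, hS.extClass.comp (Ext.mk₀ (biproduct.π (fun _ : Fin d => N) i)) (add_zero 1) = b i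

/-- `0 ⟶ M ⟶ E ⟶ N^d ⟶ 0` is a `D`-universal coextension of `M` by `N`: the sequence is exact and
the components in `Ext¹(N, M)` of its class in `Ext¹(N^d, M)` form a `D`-basis of `Ext¹(N, M)`. -/
def IsUniversalCoextensionOver (D : Type*) [Ring D] {M N E : A} [Module D (Ext.{w} N M 1)] {d : ℕ}
    (f : M ⟶ E) (g : E ⟶ ⨁ fun _ : Fin d => N) : Prop :=
  ∃ (h : f ≫ g = 0) (hS : (ShortComplex.mk f g h).ShortExact)
    (b : Module.Basis (Fin d) D (Ext.{w} N M 1)),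
    ∀ i, (Ext.mk₀ (biproduct.ι (fun _ : Fin d => N) i)).comp hS.extClass (zero_add 1) = b i

section Linear

variable (k : Type t) [Field k] [Linear k A]

/-- A `D_N`-universal extension of `M` by `N`, where `D_N` is the endomorphism ring of `N` if `N`
is a brick, and the ground field `k` otherwise. -/
def IsUniversalExtension {M N E : A} {d : ℕ} (f : (⨁ fun _ : Fin d => N) ⟶ E) (g : E ⟶ M) : Prop :=
  (IsBrick N ∧ IsUniversalExtensionOver.{w} (End N) f g) ∨
    (¬ IsBrick N ∧ IsUniversalExtensionOver.{w} k f g)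

/-- A `D_N`-universal coextension of `M` by `N`. -/
def IsUniversalCoextension {M N E : A} {d : ℕ} (f : M ⟶ E) (g : E ⟶ ⨁ fun _ : Fin d => N) : Prop :=
  (IsBrick N ∧ IsUniversalCoextensionOver.{w} (End N)ᵐᵒᵖ f g) ∨
    (¬ IsBrick N ∧ IsUniversalCoextensionOver.{w} k f g)

/-- An infinite sequence `⋯ ⟶ P₂ ⟶ P₁ ⟶ P₀ = M` of `D_N`-universal extensions by `N`. Here
`a s : P (s + 1) ⟶ P s` is the `(s + 1)`-st map of the sequence. -/
structure UniversalExtensionSequence (N M : A) where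
  P : ℕ → A
  P_zero : P 0 = M
  a : ∀ s, P (s + 1) ⟶ P s
  universal : ∀ s, ∃ (d : ℕ) (f : (⨁ fun _ : Fin d => N) ⟶ P (s + 1)),
    IsUniversalExtension.{w} k f (a s)

/-- An infinite sequence `M = Q₀ ⟶ Q₁ ⟶ Q₂ ⟶ ⋯` of `D_N`-universal coextensions by `N`. -/
structure UniversalCoextensionSequence (N M : A) where
  Q : ℕ → A
  Q_zero : Q 0 = M
  a : ∀ s, Q s ⟶ Q (s + 1)
  universal : ∀ s, ∃ (d : ℕ) (g : Q (s + 1) ⟶ ⨁ fun _ : Fin d => N),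
    IsUniversalCoextension.{w} k (a s) g

/-- The whole category `A` admits a finite sequence of universal extensions by the ordered set `Θ`:
for each `Θ i` and each object `M`, some map in the sequence of universal extensions of `M` by `Θ i`
is an isomorphism. (That `Ext¹(M, Θ i)` is finite dimensional over `D_{Θ i}` for all `M` is part of
the existence of the sequence; the sequence is unique up to isomorphism.) -/
def AdmitsFiniteUniversalExtensions {n : ℕ} (Θ : Fin n → A) : Prop :=
  ∀ (i : Fin n) (M : A), ∃ (S : UniversalExtensionSequence.{w} k (Θ i) M) (s : ℕ), IsIso (S.a s)

/-- The whole category `A` admits a finite sequence of universal coextensions by `Θ`. -/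
def AdmitsFiniteUniversalCoextensions {n : ℕ} (Θ : Fin n → A) : Prop :=
  ∀ (i : Fin n) (M : A), ∃ (S : UniversalCoextensionSequence.{w} k (Θ i) M) (s : ℕ), IsIso (S.a s)

end Linear

end Ext

end MixedStd

end

/-! Write F for `filt (⨁ Θ)`. It contains zero and is closed under extensions, hence under finite
biproducts. Given M artinian, choose f : M ⟶ X with X in F and minimal kernel
(`exists_minimal_kernel`); then every map from M to F kills ker f, so only the coimage C of f needs
an approximation. It embeds in X, with quotient X/C.

The key is `exists_orthogonal_cover`: there is an exact 0 → K → P → X/C → 0 with K in F and Ext¹(P,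
F) = 0. The pullback Z of X and P over X/C is an extension of X by K, hence lies in F, and also an
extension of P by C. As Ext¹(P, F) = 0, every map from C to F extends to Z, so M ⟶ C ⟶ Z is a left
approximation.

To build P, exhaust the universal extensions by each Θ(i) in turn, with i increasing. Termination
gives Ext¹(P, Θ(i)) = 0, and Ext¹(Θ(i), Θ(j)) = 0 for j < i preserves what was gained earlier. Part
(2) is dual, with i decreasing. -/

noncomputable section

namespace MixedStd

variable {A : Type u} [Category.{v} A] [Abelian A]

/-! ### Pullbacks and pushouts of short exact sequences. -/

section ShortExact

/-- The pullback of a short exact sequence. -/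
theorem exists_shortExact_of_isPullback {X Z Y P Q : A} {f : X ⟶ Z} {g : Z ⟶ Y} {w : f ≫ g = 0}
    (hS : (ShortComplex.mk f g w).ShortExact) {fst : Q ⟶ Z} {snd : Q ⟶ P} {p : P ⟶ Y}
    (sq : IsPullback fst snd g p) :
    ∃ (u : X ⟶ Q) (_ : u ≫ fst = f) (w' : u ≫ snd = 0),
      (ShortComplex.mk u snd w').ShortExact := by
  have := hS.mono_f
  have := hS.epi_g
  dsimp at *
  let u : X ⟶ Q := sq.lift f 0 (by simp [w])
  have hu : u ≫ fst = f := sq.lift_fst _ _ _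
  have hv : u ≫ snd = 0 := sq.lift_snd _ _ _
  have : Epi snd := by
    rw [← sq.isoPullback_hom_snd]
    infer_instance
  have : Mono u := mono_of_mono_fac hu
  refine ⟨u, hu, hv, { exact := ?_, mono_f := ‹_›, epi_g := ‹_› }⟩
  refine ShortComplex.exact_of_f_is_kernel _ (KernelFork.IsLimit.ofι' _ _ fun {W} k hk ↦ ?_)
  have hk' : (k ≫ fst) ≫ g = 0 := by
    rw [Category.assoc, sq.w, ← Category.assoc, hk, zero_comp]
  refine ⟨hS.exact.lift (k ≫ fst) hk', sq.hom_ext ?_ ?_⟩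
  · simpa [hu] using hS.exact.lift_f (k ≫ fst) hk'
  · simpa [hv] using hk.symm

/-- The preimage of a subobject of the quotient, and the quotient by it. -/
theorem shortExact_comp_of_isPullback {Z Y P P' Q : A} {g : Z ⟶ Y} [Epi g]
    {fst : Q ⟶ Z} {snd : Q ⟶ P} {p : P ⟶ Y} {q : Y ⟶ P'} {w : p ≫ q = 0}
    (hT : (ShortComplex.mk p q w).ShortExact) (sq : IsPullback fst snd g p) :
    ∃ w' : fst ≫ g ≫ q = 0, (ShortComplex.mk fst (g ≫ q) w').ShortExact := by
  have := hT.mono_f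
  have := hT.epi_g
  dsimp at *
  have w' : fst ≫ g ≫ q = 0 := by rw [← Category.assoc, sq.w, Category.assoc, w, comp_zero]
  have : Mono fst := ⟨fun a b h ↦ sq.hom_ext h (by
    rw [← cancel_mono p, Category.assoc, Category.assoc, ← sq.w, reassoc_of% h])⟩
  refine ⟨w', { exact := ?_, mono_f := ‹_›, epi_g := epi_comp _ _ }⟩
  refine ShortComplex.exact_of_f_is_kernel _ (KernelFork.IsLimit.ofι' _ _ fun {W} k hk ↦ ?_)
  have hk' : (k ≫ g) ≫ q = 0 := by simpa using hk
  exact ⟨sq.lift k (hT.exact.lift _ hk') (hT.exact.lift_f _ hk').symm, sq.lift_fst _ _ _⟩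

/-- The pushout of a short exact sequence. -/
theorem exists_shortExact_of_isPushout {X Z Y P Q : A} {f : X ⟶ Z} {g : Z ⟶ Y} {w : f ≫ g = 0}
    (hS : (ShortComplex.mk f g w).ShortExact) {p : X ⟶ P} {inl : Z ⟶ Q} {inr : P ⟶ Q}
    (sq : IsPushout f p inl inr) :
    ∃ (u : Q ⟶ Y) (_ : inl ≫ u = g) (w' : inr ≫ u = 0),
      (ShortComplex.mk inr u w').ShortExact := by
  obtain ⟨u, h₁, h₂, h⟩ := exists_shortExact_of_isPullback hS.op sq.flip.op
  exact ⟨u.unop, Quiver.Hom.op_inj h₁, Quiver.Hom.op_inj h₂, h.unop⟩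

/-- The quotient of an extension by a subobject of the kernel. -/
theorem shortExact_comp_of_isPushout {X Z P P' Q : A} {f : X ⟶ Z} [Mono f]
    {p : X ⟶ P} {inl : Z ⟶ Q} {inr : P ⟶ Q} {q : P' ⟶ X} {w : q ≫ p = 0}
    (hT : (ShortComplex.mk q p w).ShortExact) (sq : IsPushout f p inl inr) :
    ∃ w' : (q ≫ f) ≫ inl = 0, (ShortComplex.mk (q ≫ f) inl w').ShortExact := by
  obtain ⟨h₁, h⟩ := shortExact_comp_of_isPullback hT.op sq.flip.op
  exact ⟨Quiver.Hom.op_inj h₁, h.unop⟩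

theorem shortExact_of_mono {X Y : A} (f : X ⟶ Y) [Mono f] :
    (ShortComplex.mk f (cokernel.π f) (cokernel.condition f)).ShortExact where
  exact := ShortComplex.exact_cokernel f

theorem shortExact_of_epi {X Y : A} (f : X ⟶ Y) [Epi f] :
    (ShortComplex.mk (kernel.ι f) f (kernel.condition f)).ShortExact where
  exact := ShortComplex.exact_kernel f

end ShortExact

/-! ### Closure properties of filtered objects. -/

section Filtrations

/-- The retraction splits the inclusion, so the cokernel serves as the complement. -/
theorem add_of_retract {M X : A} {n : ℕ} (r : Retract X (⨁ fun _ : Fin n => M)) : add M X := by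
  have h : (ShortComplex.mk r.i (cokernel.π r.i) (cokernel.condition _)).Exact :=
    ShortComplex.exact_cokernel _
  exact ⟨n, _, ⟨(ShortComplex.Splitting.ofExactOfRetraction _ h r.r r.retract
    (inferInstanceAs (Epi (cokernel.π r.i)))).isoBinaryBiproduct.symm⟩⟩

theorem exists_retract_of_add {M X : A} (h : add M X) :
    ∃ n : ℕ, Nonempty (Retract X (⨁ fun _ : Fin n => M)) := by
  obtain ⟨n, Y, ⟨e⟩⟩ := h
  exact ⟨n, ⟨biprod.inl ≫ e.hom, e.inv ≫ biprod.fst, by simp⟩⟩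

/-- Induction on the number of factors of Y. If Y is an extension of V by U with V in `add M`, the
preimage of U in Z is an extension of U by X, and its quotient in Z is V; this matches the left
bracketing of `starPow`. -/
theorem filt_of_shortExact {M X Y Z : A} {f : X ⟶ Z} {g : Z ⟶ Y} {w : f ≫ g = 0}
    (hS : (ShortComplex.mk f g w).ShortExact) (hX : filt M X) (hY : filt M Y) : filt M Z := by
  obtain ⟨m, hm⟩ := hY
  induction m generalizing Y Z X with
  | zero =>
    obtain ⟨l, hl⟩ := hX
    exact ⟨l + 1, X, Y, f, g, w, hS, hl, hm⟩
  | succ m ih =>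
    obtain ⟨U, V, p, q, w', hT, hU, hV⟩ := hm
    have sq := IsPullback.of_hasPullback g p
    obtain ⟨u, hu, wu, h⟩ := exists_shortExact_of_isPullback hS sq
    have : Epi g := hS.epi_g
    obtain ⟨w'', h'⟩ := shortExact_comp_of_isPullback hT sq
    obtain ⟨l, hl⟩ := ih h hX hU
    exact ⟨l + 1, _, _, _, _, _, h', hl, hV⟩

theorem filt_of_add {M X : A} (h : add M X) : filt M X := ⟨0, h⟩

theorem filt_of_isZero {M X : A} (h : IsZero X) : filt M X :=
  filt_of_add (add_of_retract (n := 0) ⟨0, 0, h.eq_of_src _ _⟩)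

theorem filt_biprod {M X Y : A} (hX : filt M X) (hY : filt M Y) : filt M (X ⊞ Y) :=
  filt_of_shortExact (w := by simp)
    (ShortComplex.Splitting.shortExact (S := ShortComplex.mk (biprod.inl : X ⟶ X ⊞ Y) biprod.snd
      (by simp)) (ShortComplex.Splitting.ofHasBinaryBiproduct X Y)) hX hY

theorem filt_biproduct_summand {n : ℕ} (Θ : Fin n → A) (i : Fin n) (d : ℕ) :
    filt (⨁ Θ) (⨁ fun _ : Fin d => Θ i) :=
  filt_of_add (add_of_retract (n := d)
    ⟨biproduct.map fun _ => biproduct.ι Θ i, biproduct.map fun _ => biproduct.π Θ i, by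
      ext; simp⟩)

/-- Composition of two epimorphisms with filtered kernels. -/
theorem exists_filt_kernel_comp {T M P P' K K' : A} {f : K ⟶ P} {g : P ⟶ M} {w : f ≫ g = 0}
    (hS : (ShortComplex.mk f g w).ShortExact) {f' : K' ⟶ P'} {g' : P' ⟶ P} {w' : f' ≫ g' = 0}
    (hS' : (ShortComplex.mk f' g' w').ShortExact) (hK : filt T K) (hK' : filt T K') :
    ∃ (L : A) (i : L ⟶ P') (p : P' ⟶ M) (w : i ≫ p = 0),
      (ShortComplex.mk i p w).ShortExact ∧ filt T L := by
  have sq := IsPullback.of_hasPullback g' f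
  obtain ⟨u, hu, wu, h⟩ := exists_shortExact_of_isPullback hS' sq
  have : Epi g' := hS'.epi_g
  obtain ⟨w'', h'⟩ := shortExact_comp_of_isPullback hS sq
  exact ⟨_, _, _, _, h', filt_of_shortExact h hK' hK⟩

/-- Composition of two monomorphisms with filtered cokernels. -/
theorem exists_filt_cokernel_comp {T M P P' K K' : A} {f : M ⟶ P} {g : P ⟶ K} {w : f ≫ g = 0}
    (hS : (ShortComplex.mk f g w).ShortExact) {f' : P ⟶ P'} {g' : P' ⟶ K'} {w' : f' ≫ g' = 0}
    (hS' : (ShortComplex.mk f' g' w').ShortExact) (hK : filt T K) (hK' : filt T K') :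
    ∃ (L : A) (i : M ⟶ P') (p : P' ⟶ L) (w : i ≫ p = 0),
      (ShortComplex.mk i p w).ShortExact ∧ filt T L := by
  have sq := IsPushout.of_hasPushout f' g
  obtain ⟨u, hu, wu, h⟩ := exists_shortExact_of_isPushout hS' sq
  have : Mono f' := hS'.mono_f
  obtain ⟨w'', h'⟩ := shortExact_comp_of_isPushout hS sq
  exact ⟨_, _, _, _, h', filt_of_shortExact h hK hK'⟩

end Filtrations

/-! ### Minimal kernels and maximal images. -/

section Chain

/-- In an artinian object there is a smallest kernel of a map to an object of a class closed under
binary biproducts. -/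
theorem exists_minimal_kernel {F : ObjectProperty A} (hF₀ : ∃ X, F X)
    (hF : ∀ X Y, F X → F Y → F (X ⊞ Y)) (M : A) [IsArtinianObject M] :
    ∃ (X : A) (f : M ⟶ X), F X ∧ ∀ Y, F Y → ∀ g : M ⟶ Y, kernel.ι f ≫ g = 0 := by
  let s : Set (Subobject M) := {K | ∃ (X : A) (f : M ⟶ X), F X ∧ kernelSubobject f = K}
  obtain ⟨X₀, hX₀⟩ := hF₀
  obtain ⟨K, ⟨X, f, hX, rfl⟩, hK⟩ := wellFounded_lt.has_min s ⟨_, X₀, 0, hX₀, rfl⟩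
  refine ⟨X, f, hX, fun Y hY g ↦ ?_⟩
  -- The kernel of `biprod.lift f g` is ker f ∩ ker g; minimality makes it all of ker f.
  have hle : kernelSubobject (biprod.lift f g) ≤ kernelSubobject f := by
    simpa using kernelSubobject_comp_le (biprod.lift f g) biprod.fst
  have heq := hle.eq_of_not_lt (hK _ ⟨_, biprod.lift f g, hF _ _ hX hY, rfl⟩)
  have h : (kernelSubobject (biprod.lift f g)).Factors (kernel.ι f) := by
    rw [heq, kernelSubobject_factors_iff, kernel.condition]
  rw [kernelSubobject_factors_iff] at h
  simpa using h =≫ biprod.snd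

/-- In a noetherian object there is a largest image of a map from an object of a class closed under
binary biproducts. -/
theorem exists_maximal_image {F : ObjectProperty A} (hF₀ : ∃ X, F X)
    (hF : ∀ X Y, F X → F Y → F (X ⊞ Y)) (M : A) [IsNoetherianObject M] :
    ∃ (X : A) (f : X ⟶ M), F X ∧ ∀ Y, F Y → ∀ g : Y ⟶ M, g ≫ cokernel.π f = 0 := by
  -- The image of f is encoded as the kernel of its cokernel, so that inclusions become
  -- factorizations.
  let s : Set (Subobject M) :=
    {K | ∃ (X : A) (f : X ⟶ M), F X ∧ kernelSubobject (cokernel.π f) = K}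
  obtain ⟨X₀, hX₀⟩ := hF₀
  obtain ⟨K, ⟨X, f, hX, rfl⟩, hK⟩ := wellFounded_gt.has_min s ⟨_, X₀, 0, hX₀, rfl⟩
  refine ⟨X, f, hX, fun Y hY g ↦ ?_⟩
  have hle : kernelSubobject (cokernel.π f) ≤
      kernelSubobject (cokernel.π (biprod.desc f g)) := by
    have h : f ≫ cokernel.π (biprod.desc f g) = 0 := by
      have := biprod.inl ≫= cokernel.condition (biprod.desc f g)
      rwa [comp_zero, biprod.inl_desc_assoc] at this
    simpa using kernelSubobject_comp_le (cokernel.π f) (cokernel.desc f _ h)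
  have heq := hle.eq_of_not_lt (hK _ ⟨_, biprod.desc f g, hF _ _ hX hY, rfl⟩)
  have h : (kernelSubobject (cokernel.π f)).Factors g := by
    rw [heq, kernelSubobject_factors_iff]
    have := biprod.inr ≫= cokernel.condition (biprod.desc f g)
    rwa [comp_zero, biprod.inr_desc_assoc] at this
  rwa [kernelSubobject_factors_iff] at h

end Chain

/-! ### Vanishing of Ext¹ and its consequences for maps. -/

section Ext

variable [HasExt.{w} A]

theorem ext_eq_zero_of_shortExact_left {X Y Z N : A} {f : X ⟶ Z} {g : Z ⟶ Y} {w : f ≫ g = 0}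
    (hS : (ShortComplex.mk f g w).ShortExact) (hX : ∀ e : Ext.{w} X N 1, e = 0)
    (hY : ∀ e : Ext.{w} Y N 1, e = 0) (e : Ext.{w} Z N 1) : e = 0 := by
  obtain ⟨x, hx⟩ := Ext.contravariant_sequence_exact₂ hS N e (hX _)
  rw [← hx, hY x, Ext.comp_zero]

theorem ext_eq_zero_of_shortExact_right {X Y Z N : A} {f : X ⟶ Z} {g : Z ⟶ Y} {w : f ≫ g = 0}
    (hS : (ShortComplex.mk f g w).ShortExact) (hX : ∀ e : Ext.{w} N X 1, e = 0)
    (hY : ∀ e : Ext.{w} N Y 1, e = 0) (e : Ext.{w} N Z 1) : e = 0 := by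
  obtain ⟨x, hx⟩ := Ext.covariant_sequence_exact₂ N hS e (hY _)
  rw [← hx, hX x, Ext.zero_comp]

theorem ext_biproduct_eq_zero {d : ℕ} {X : Fin d → A} {N : A}
    (h : ∀ i, ∀ e : Ext.{w} (X i) N 1, e = 0) (e : Ext.{w} (⨁ X) N 1) : e = 0 :=
  (Ext.biproductAddEquiv (biproduct.isBilimit X) N 1).injective
    (funext fun i ↦ (h i _).trans (h i _).symm)

theorem ext_to_biproduct_eq_zero {d : ℕ} {X : Fin d → A} {N : A}
    (h : ∀ i, ∀ e : Ext.{w} N (X i) 1, e = 0) (e : Ext.{w} N (⨁ X) 1) : e = 0 :=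
  (Ext.addEquivBiproduct N (biproduct.isBilimit X) 1).injective
    (funext fun i ↦ (h i _).trans (h i _).symm)

theorem ext_eq_zero_of_retract_left {X Y N : A} (r : Retract X Y)
    (h : ∀ e : Ext.{w} Y N 1, e = 0) (e : Ext.{w} X N 1) : e = 0 := by
  rw [← Ext.mk₀_id_comp e, ← r.retract, ← Ext.mk₀_comp_mk₀,
    Ext.comp_assoc _ _ _ (zero_add 0) (zero_add 1) (by lia), h ((Ext.mk₀ r.r).comp e _),
    Ext.comp_zero]

theorem ext_eq_zero_of_retract_right {X Y N : A} (r : Retract X Y)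
    (h : ∀ e : Ext.{w} N Y 1, e = 0) (e : Ext.{w} N X 1) : e = 0 := by
  rw [← Ext.comp_mk₀_id e, ← r.retract, ← Ext.mk₀_comp_mk₀,
    ← Ext.comp_assoc_of_third_deg_zero, h (e.comp (Ext.mk₀ r.i) _), Ext.zero_comp]

/-- Dévissage along the filtration: vanishing on the Θ(i) passes to sums, summands and extensions.
-/
theorem ext_filt_eq_zero {n : ℕ} {Θ : Fin n → A} {N : A}
    (h : ∀ i, ∀ e : Ext.{w} N (Θ i) 1, e = 0) {X : A} (hX : filt (⨁ Θ) X)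
    (e : Ext.{w} N X 1) : e = 0 := by
  have hadd : ∀ Y, add (⨁ Θ) Y → ∀ e : Ext.{w} N Y 1, e = 0 := fun Y hY ↦ by
    obtain ⟨d, ⟨r⟩⟩ := exists_retract_of_add hY
    exact ext_eq_zero_of_retract_right r
      (ext_to_biproduct_eq_zero fun _ ↦ ext_to_biproduct_eq_zero h)
  obtain ⟨l, hl⟩ := hX
  induction l generalizing X with
  | zero => exact hadd X hl e
  | succ l ih =>
    obtain ⟨U, V, f, g, w', hS, hU, hV⟩ := hl
    exact ext_eq_zero_of_shortExact_right hS (ih · hU) (hadd V hV) e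

theorem ext_of_filt_eq_zero {n : ℕ} {Θ : Fin n → A} {N : A}
    (h : ∀ i, ∀ e : Ext.{w} (Θ i) N 1, e = 0) {X : A} (hX : filt (⨁ Θ) X)
    (e : Ext.{w} X N 1) : e = 0 := by
  have hadd : ∀ Y, add (⨁ Θ) Y → ∀ e : Ext.{w} Y N 1, e = 0 := fun Y hY ↦ by
    obtain ⟨d, ⟨r⟩⟩ := exists_retract_of_add hY
    exact ext_eq_zero_of_retract_left r
      (ext_biproduct_eq_zero fun _ ↦ ext_biproduct_eq_zero h)
  obtain ⟨l, hl⟩ := hX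
  induction l generalizing X with
  | zero => exact hadd X hl e
  | succ l ih =>
    obtain ⟨U, V, f, g, w', hS, hU, hV⟩ := hl
    exact ext_eq_zero_of_shortExact_left hS (ih · hU) (hadd V hV) e

/-- A map extends along a monomorphism if the extension group of the cokernel vanishes. -/
theorem exists_extension {X Y Z N : A} {f : X ⟶ Z} {g : Z ⟶ Y} {w : f ≫ g = 0}
    (hS : (ShortComplex.mk f g w).ShortExact) (hY : ∀ e : Ext.{w} Y N 1, e = 0) (a : X ⟶ N) :
    ∃ b : Z ⟶ N, f ≫ b = a := by
  obtain ⟨x, hx⟩ := Ext.contravariant_sequence_exact₁ hS N (Ext.mk₀ a) (add_zero 1) (hY _)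
  obtain ⟨b, rfl⟩ := (Ext.mk₀_bijective _ _).2 x
  exact ⟨b, (Ext.mk₀_bijective _ _).1 (by rw [← Ext.mk₀_comp_mk₀]; exact hx)⟩

/-- A map lifts along an epimorphism if the extension group into the kernel vanishes. -/
theorem exists_lift {X Y Z N : A} {f : X ⟶ Z} {g : Z ⟶ Y} {w : f ≫ g = 0}
    (hS : (ShortComplex.mk f g w).ShortExact) (hX : ∀ e : Ext.{w} N X 1, e = 0) (a : N ⟶ Y) :
    ∃ b : N ⟶ Z, b ≫ g = a := by
  obtain ⟨x, hx⟩ := Ext.covariant_sequence_exact₃ N hS (Ext.mk₀ a) (zero_add 1) (hX _)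
  obtain ⟨b, rfl⟩ := (Ext.mk₀_bijective _ _).2 x
  exact ⟨b, (Ext.mk₀_bijective _ _).1 (by rw [← Ext.mk₀_comp_mk₀]; exact hx)⟩

theorem basis_eq_zero {D V : Type*} [Ring D] [AddCommGroup V] [Module D V] {d : ℕ}
    (b : Module.Basis (Fin d) D V) (h : ∀ i, b i = 0) (x : V) : x = 0 := by
  rw [← b.sum_repr x]
  exact Finset.sum_eq_zero fun i _ ↦ by rw [h, smul_zero]

/-- If g is an isomorphism, its kernel N^d is zero, so the components of the class, which form a
basis of Ext¹(M, N), all vanish. -/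
theorem IsUniversalExtensionOver.ext_eq_zero {D : Type*} [Ring D] {M N E : A}
    [Module D (Ext.{w} M N 1)] {d : ℕ} {f : (⨁ fun _ : Fin d => N) ⟶ E} {g : E ⟶ M} [IsIso g]
    (h : IsUniversalExtensionOver.{w} D f g) (e : Ext.{w} M N 1) : e = 0 := by
  obtain ⟨w', hS, b, hb⟩ := h
  have : Mono f := hS.mono_f
  have hf : f = 0 := by rw [← cancel_mono g, w', zero_comp]
  have hz : IsZero (⨁ fun _ : Fin d => N) := IsZero.of_mono_eq_zero f hf
  exact basis_eq_zero b (fun i ↦ by rw [← hb, hz.eq_of_src (biproduct.π _ i) 0, Ext.mk₀_zero,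
    Ext.comp_zero]) e

theorem IsUniversalCoextensionOver.ext_eq_zero {D : Type*} [Ring D] {M N E : A}
    [Module D (Ext.{w} N M 1)] {d : ℕ} {f : M ⟶ E} {g : E ⟶ ⨁ fun _ : Fin d => N} [IsIso f]
    (h : IsUniversalCoextensionOver.{w} D f g) (e : Ext.{w} N M 1) : e = 0 := by
  obtain ⟨w', hS, b, hb⟩ := h
  have : Epi g := hS.epi_g
  have hg : g = 0 := by rw [← cancel_epi f, w', comp_zero]
  have hz : IsZero (⨁ fun _ : Fin d => N) := IsZero.of_epi_eq_zero g hg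
  exact basis_eq_zero b (fun i ↦ by rw [← hb, hz.eq_of_tgt (biproduct.ι _ i) 0, Ext.mk₀_zero,
    Ext.zero_comp]) e

/-! ### Universal extension sequences and orthogonal covers. -/

section Linear

variable {k : Type t} [Field k] [Linear k A]

theorem IsUniversalExtension.shortExact {M N E : A} {d : ℕ} {f : (⨁ fun _ : Fin d => N) ⟶ E}
    {g : E ⟶ M} (h : IsUniversalExtension.{w} k f g) :
    ∃ w' : f ≫ g = 0, (ShortComplex.mk f g w').ShortExact := by
  obtain ⟨_, w', hS, _⟩ | ⟨_, w', hS, _⟩ := h <;> exact ⟨w', hS⟩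

theorem IsUniversalExtension.ext_eq_zero {M N E : A} {d : ℕ} {f : (⨁ fun _ : Fin d => N) ⟶ E}
    {g : E ⟶ M} [IsIso g] (h : IsUniversalExtension.{w} k f g) (e : Ext.{w} M N 1) : e = 0 := by
  obtain ⟨_, h⟩ | ⟨_, h⟩ := h <;> exact h.ext_eq_zero e

theorem IsUniversalCoextension.shortExact {M N E : A} {d : ℕ} {f : M ⟶ E}
    {g : E ⟶ ⨁ fun _ : Fin d => N} (h : IsUniversalCoextension.{w} k f g) :
    ∃ w' : f ≫ g = 0, (ShortComplex.mk f g w').ShortExact := by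
  obtain ⟨_, w', hS, _⟩ | ⟨_, w', hS, _⟩ := h <;> exact ⟨w', hS⟩

theorem IsUniversalCoextension.ext_eq_zero {M N E : A} {d : ℕ} {f : M ⟶ E}
    {g : E ⟶ ⨁ fun _ : Fin d => N} [IsIso f] (h : IsUniversalCoextension.{w} k f g)
    (e : Ext.{w} N M 1) : e = 0 := by
  obtain ⟨_, h⟩ | ⟨_, h⟩ := h <;> exact h.ext_eq_zero e

variable {n : ℕ} {Θ : Fin n → A}

/-- An object of a sequence of universal extensions by `Θ i` covers the first object with filtered
kernel, and inherits the vanishing of extensions by the `Y` with `Ext¹(Θ i, Y) = 0`. -/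
theorem UniversalExtensionSequence.exists_cover {i : Fin n} {M : A}
    (S : UniversalExtensionSequence.{w} k (Θ i) M) (s : ℕ) :
    (∃ (K : A) (f : K ⟶ S.P s) (g : S.P s ⟶ M) (w' : f ≫ g = 0),
      (ShortComplex.mk f g w').ShortExact ∧ filt (⨁ Θ) K) ∧
    ∀ Y : A, (∀ e : Ext.{w} (Θ i) Y 1, e = 0) → (∀ e : Ext.{w} M Y 1, e = 0) →
      ∀ e : Ext.{w} (S.P s) Y 1, e = 0 := by
  induction s with
  | zero =>
    obtain ⟨P, rfl, a, hu⟩ := S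
    exact ⟨⟨_, _, _, _, shortExact_of_epi (𝟙 (P 0)), filt_of_isZero (isZero_kernel_of_mono _)⟩,
      fun _ _ h ↦ h⟩
  | succ s ih =>
    obtain ⟨⟨K, f, g, w', hS, hK⟩, hY⟩ := ih
    obtain ⟨d, f', hu⟩ := S.universal s
    obtain ⟨w'', hS'⟩ := hu.shortExact
    exact ⟨exists_filt_kernel_comp hS hS' hK (filt_biproduct_summand Θ i d), fun Y h₁ h₂ ↦
      ext_eq_zero_of_shortExact_left hS' (ext_biproduct_eq_zero fun _ ↦ h₁) (hY Y h₁ h₂)⟩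

/-- The dual of `UniversalExtensionSequence.exists_cover`. -/
theorem UniversalCoextensionSequence.exists_hull {i : Fin n} {M : A}
    (S : UniversalCoextensionSequence.{w} k (Θ i) M) (s : ℕ) :
    (∃ (K : A) (f : M ⟶ S.Q s) (g : S.Q s ⟶ K) (w' : f ≫ g = 0),
      (ShortComplex.mk f g w').ShortExact ∧ filt (⨁ Θ) K) ∧
    ∀ Y : A, (∀ e : Ext.{w} Y (Θ i) 1, e = 0) → (∀ e : Ext.{w} Y M 1, e = 0) →
      ∀ e : Ext.{w} Y (S.Q s) 1, e = 0 := by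
  induction s with
  | zero =>
    obtain ⟨P, rfl, a, hu⟩ := S
    exact ⟨⟨_, _, _, _, shortExact_of_mono (𝟙 (P 0)), filt_of_isZero (isZero_cokernel_of_epi _)⟩,
      fun _ _ h ↦ h⟩
  | succ s ih =>
    obtain ⟨⟨K, f, g, w', hS, hK⟩, hY⟩ := ih
    obtain ⟨d, g', hu⟩ := S.universal s
    obtain ⟨w'', hS'⟩ := hu.shortExact
    exact ⟨exists_filt_cokernel_comp hS hS' hK (filt_biproduct_summand Θ i d), fun Y h₁ h₂ ↦
      ext_eq_zero_of_shortExact_right hS' (hY Y h₁ h₂) (ext_to_biproduct_eq_zero fun _ ↦ h₁)⟩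

/-- Every object `M` is covered, with filtered kernel, by some `P` with `Ext¹(P, ℱ(Θ)) = 0`. -/
theorem exists_orthogonal_cover (hΘ : ∀ i j, j < i → ∀ e : Ext.{w} (Θ i) (Θ j) 1, e = 0)
    (hext : AdmitsFiniteUniversalExtensions.{w} k Θ) (M : A) :
    ∃ (K P : A) (f : K ⟶ P) (g : P ⟶ M) (w' : f ≫ g = 0),
      (ShortComplex.mk f g w').ShortExact ∧ filt (⨁ Θ) K ∧
      ∀ X, filt (⨁ Θ) X → ∀ e : Ext.{w} P X 1, e = 0 := by
  suffices h : ∀ m : ℕ, m ≤ n → ∃ (K P : A) (f : K ⟶ P) (g : P ⟶ M) (w' : f ≫ g = 0),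
      (ShortComplex.mk f g w').ShortExact ∧ filt (⨁ Θ) K ∧
      ∀ j : Fin n, j.val < m → ∀ e : Ext.{w} P (Θ j) 1, e = 0 by
    obtain ⟨K, P, f, g, w', hS, hK, hP⟩ := h n le_rfl
    exact ⟨K, P, f, g, w', hS, hK, fun X ↦ ext_filt_eq_zero fun i ↦ hP i i.isLt⟩
  intro m
  induction m with
  | zero =>
    exact fun _ ↦ ⟨_, _, _, _, _, shortExact_of_epi (𝟙 M),
      filt_of_isZero (isZero_kernel_of_mono _), fun _ h ↦ absurd h (Nat.not_lt_zero _)⟩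
  | succ m ih =>
    intro hm
    obtain ⟨K, P, f, g, w', hS, hK, hP⟩ := ih (Nat.le_of_succ_le hm)
    obtain ⟨S, s, hs⟩ := hext ⟨m, hm⟩ P
    obtain ⟨⟨K', f', g', w'', hS', hK'⟩, hY⟩ := S.exists_cover s
    obtain ⟨L, i, p, wL, hL, hFL⟩ := exists_filt_kernel_comp hS hS' hK hK'
    refine ⟨L, S.P s, i, p, wL, hL, hFL, fun j hj ↦ ?_⟩
    obtain hj | hj := Nat.lt_succ_iff_lt_or_eq.mp hj
    -- Here j precedes m, so Ext¹(Θ(m), Θ(j)) = 0 and the earlier vanishing survives.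
    · exact hY _ (hΘ _ _ hj) (hP j hj)
    · obtain rfl : j = ⟨m, hm⟩ := Fin.ext hj
      -- `S.a s` is an extension of its target `S.P s`, so its invertibility gives the vanishing
      -- already at stage s.
      obtain ⟨d, f, hu⟩ := S.universal s
      exact hu.ext_eq_zero

/-- Every object `M` embeds, with filtered cokernel, into some `Q` with `Ext¹(ℱ(Θ), Q) = 0`. -/
theorem exists_orthogonal_hull (hΘ : ∀ i j, j < i → ∀ e : Ext.{w} (Θ i) (Θ j) 1, e = 0)
    (hext : AdmitsFiniteUniversalCoextensions.{w} k Θ) (M : A) :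
    ∃ (K Q : A) (f : M ⟶ Q) (g : Q ⟶ K) (w' : f ≫ g = 0),
      (ShortComplex.mk f g w').ShortExact ∧ filt (⨁ Θ) K ∧
      ∀ X, filt (⨁ Θ) X → ∀ e : Ext.{w} X Q 1, e = 0 := by
  suffices h : ∀ m : ℕ, m ≤ n → ∃ (K Q : A) (f : M ⟶ Q) (g : Q ⟶ K) (w' : f ≫ g = 0),
      (ShortComplex.mk f g w').ShortExact ∧ filt (⨁ Θ) K ∧
      ∀ j : Fin n, n ≤ j.val + m → ∀ e : Ext.{w} (Θ j) Q 1, e = 0 by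
    obtain ⟨K, Q, f, g, w', hS, hK, hQ⟩ := h n le_rfl
    exact ⟨K, Q, f, g, w', hS, hK, fun X ↦ ext_of_filt_eq_zero fun i ↦ hQ i (by lia)⟩
  intro m
  induction m with
  | zero =>
    exact fun _ ↦ ⟨_, _, _, _, _, shortExact_of_mono (𝟙 M),
      filt_of_isZero (isZero_cokernel_of_epi _), fun _ h ↦ by lia⟩
  | succ m ih =>
    intro hm
    obtain ⟨K, Q, f, g, w', hS, hK, hQ⟩ := ih (Nat.le_of_succ_le hm)
    -- Coextensions run from the last index down: keeping Ext¹(Θ(j), Q) = 0 requires Ext¹(Θ(j),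
    -- Θ(i₀)) = 0, available for j > i₀.
    let i₀ : Fin n := ⟨n - (m + 1), by lia⟩
    obtain ⟨S, s, hs⟩ := hext i₀ Q
    obtain ⟨⟨K', f', g', w'', hS', hK'⟩, hY⟩ := S.exists_hull s
    obtain ⟨L, i, p, wL, hL, hFL⟩ := exists_filt_cokernel_comp hS hS' hK hK'
    refine ⟨L, S.Q s, i, p, wL, hL, hFL, fun j hj ↦ ?_⟩
    by_cases h : n ≤ j.val + m
    · exact hY _ (hΘ _ _ (Fin.lt_def.mpr (by dsimp [i₀]; lia))) (hQ j h)
    · obtain rfl : j = i₀ := Fin.ext (by dsimp [i₀]; lia)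
      obtain ⟨d, f, hu⟩ := S.universal s
      exact hu.ext_eq_zero

/-! ### Construction of the approximations. -/

theorem covariantlyFinite_filt (hA : IsLengthCategory A)
    (hΘ : ∀ i j, j < i → ∀ e : Ext.{w} (Θ i) (Θ j) 1, e = 0)
    (hext : AdmitsFiniteUniversalExtensions.{w} k Θ) : CovariantlyFinite (filt (⨁ Θ)) := by
  intro M
  have := (hA M).2
  obtain ⟨X, f, hX, hmin⟩ := exists_minimal_kernel (F := filt (⨁ Θ))
    ⟨_, filt_of_isZero (isZero_kernel_of_mono (𝟙 M))⟩ (fun _ _ ↦ filt_biprod) M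
  have hS := shortExact_of_mono (Abelian.factorThruCoimage f)
  obtain ⟨K, P, i, p, wP, hP, hK, hort⟩ :=
    exists_orthogonal_cover hΘ hext (cokernel (Abelian.factorThruCoimage f))
  have sq := IsPullback.of_hasPullback (cokernel.π (Abelian.factorThruCoimage f)) p
  obtain ⟨u, -, wu, hu⟩ := exists_shortExact_of_isPullback hS sq
  obtain ⟨u', -, wu', hu'⟩ := exists_shortExact_of_isPullback hP sq.flip
  -- The pullback is read two ways: `hu'` (kernel K, quotient X) puts it in the class, `hu` (kernel
  -- the coimage, quotient P) gives the extension of maps.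
  refine ⟨_, Abelian.coimage.π f ≫ u, filt_of_shortExact hu' hK hX, fun Y hY g ↦ ?_⟩
  obtain ⟨b, hb⟩ := exists_extension hu (hort Y hY) (cokernel.desc _ g (hmin Y hY g))
  exact ⟨b, by rw [Category.assoc, hb]; exact cokernel.π_desc _ _ _⟩

theorem contravariantlyFinite_filt (hA : IsLengthCategory A)
    (hΘ : ∀ i j, j < i → ∀ e : Ext.{w} (Θ i) (Θ j) 1, e = 0)
    (hext : AdmitsFiniteUniversalCoextensions.{w} k Θ) :
    ContravariantlyFinite (filt (⨁ Θ)) := by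
  intro M
  have := (hA M).1
  obtain ⟨X, f, hX, hmax⟩ := exists_maximal_image (F := filt (⨁ Θ))
    ⟨_, filt_of_isZero (isZero_kernel_of_mono (𝟙 M))⟩ (fun _ _ ↦ filt_biprod) M
  have hS := shortExact_of_epi (Abelian.factorThruImage f)
  obtain ⟨K, Q, i, p, wQ, hQ, hK, hort⟩ :=
    exists_orthogonal_hull hΘ hext (kernel (Abelian.factorThruImage f))
  have sq := IsPushout.of_hasPushout (kernel.ι (Abelian.factorThruImage f)) i
  obtain ⟨u, -, wu, hu⟩ := exists_shortExact_of_isPushout hS sq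
  obtain ⟨u', -, wu', hu'⟩ := exists_shortExact_of_isPushout hQ sq.flip
  refine ⟨_, u ≫ Abelian.image.ι f, filt_of_shortExact hu' hX hK, fun Y hY g ↦ ?_⟩
  obtain ⟨b, hb⟩ := exists_lift hu (hort Y hY) (kernel.lift _ g (hmax Y hY g))
  exact ⟨b, by rw [← Category.assoc, hb]; exact kernel.lift_ι _ _ _⟩

end Linear

end Ext

end MixedStd

end

theorem mainTheorem11 (k : Type t) [Field k] (A : Type u) [Category.{v} A] [Abelian A]
    [Linear k A] [HasExt.{w} A] (hA : MixedStd.IsLengthCategory A)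
    (n : ℕ) (Θ : Fin n → A) (hΘ : MixedStd.IsMixedStandardizable.{w} Θ)
    (hfin : MixedStd.ExtFinite.{w} k (MixedStd.add (⨁ Θ)))
    (hext : MixedStd.AdmitsFiniteUniversalExtensions.{w} k Θ) :
    MixedStd.CovariantlyFinite (MixedStd.filt (⨁ Θ)) ∧
      (MixedStd.AdmitsFiniteUniversalCoextensions.{w} k Θ →
        MixedStd.FunctoriallyFinite (MixedStd.filt (⨁ Θ))) := by
  have hcov := MixedStd.covariantlyFinite_filt hA hΘ.ext_eq_zero hext
  exact ⟨hcov, fun hcoext ↦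
    ⟨hcov, MixedStd.contravariantlyFinite_filt hA hΘ.ext_eq_zero hcoext⟩⟩
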